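/- There is a universal constant $C>0$ such that the following holds. For every $\varepsilon\in(0,1)$, every $\delta\in(0,1/2)$, every $k,n\in\mathbb{N}$ and every data universe $\mathcal{X}$, there is a randomized algorithm that receives $k$ queries $f_1,\dots,f_k:\mathcal{X}^n\to\mathbb{R}$ and a dataset $D\in\mathcal{X}^n$, releases a random vector $\tilde f=(\tilde f_1,\dots,\tilde f_k)\in\mathbb{R}^k$, and has the following two properties whenever each $f_i$ has sensitivity $1$ (that is, $|f_i(D)-f_i(D')|\le 1$ for all datasets $D,D'\in\mathcal{X}^n$ that differ in at most one record). (1) For the fixed queries $f_1,\dots,f_k$ the algorithm is $(\varepsilon,\delta)$-differentially private in $D$: for all $D,D'\in\mathcal{X}^n$ differing in at most one record and all measurable $S\subseteq\mathbb{R}^k$, the output $\tilde f$ satisfies $\Pr[\tilde f(D)\in S]\le e^{\varepsilon}\Pr[\tilde f(D')\in S]+\delta$. (2) For every dataset $D\in\mathcal{X}^n$, $$\Pr_{\tilde f}\left[\max_{1\le i\le k}|f_i(D)-\tilde f_i|\le C\,\frac{\sqrt{k\log(1/\delta)}+\log(1/\delta)}{\varepsilon}\right]=1 .$$ -/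

import Mathlib

namespace QueryRelease

/-- A dataset of size `n` over the data universe `X`, i.e. an element of `X ^ n`. -/
abbrev Dataset (X : Type*) (n : ℕ) := Fin n → X

/-- Two datasets of the same size are neighboring if they differ in at most one record. -/
def Neighboring {X : Type*} {n : ℕ} (D D' : Dataset X n) : Prop :=
  ∃ i : Fin n, ∀ j : Fin n, j ≠ i → D j = D' j

/-- A real-valued query has sensitivity (at most) `1` if changing one record of the dataset changes
its value by at most `1`. -/
def HasSensitivityOne {X : Type*} {n : ℕ} (f : Dataset X n → ℝ) : Prop :=
  ∀ D D' : Dataset X n, Neighboring D D' → |f D - f D'| ≤ 1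

/-- A randomized algorithm, given by the law of its output on every dataset, is
`(ε, δ)`-differentially private if `Pr[M(D) ∈ S] ≤ e ^ ε * Pr[M(D') ∈ S] + δ` for all neighboring
datasets `D`, `D'` and all measurable sets `S` of outputs. -/
def IsDP {X Y : Type*} {n : ℕ} [MeasurableSpace Y] (ε δ : ℝ)
    (M : Dataset X n → MeasureTheory.ProbabilityMeasure Y) : Prop :=
  ∀ D D' : Dataset X n, Neighboring D D' → ∀ S : Set Y, MeasurableSet S →
    (M D : MeasureTheory.Measure Y) S ≤
      ENNReal.ofReal (Real.exp ε) * (M D' : MeasureTheory.Measure Y) S + ENNReal.ofReal δ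

/-- A query-releasing algorithm: it receives `k` queries and a dataset, and releases a random vector
of `k` real answers. (The norm of `Fin k → ℝ` is the sup norm.) -/
abbrev QueryAlgorithm (X : Type*) (n k : ℕ) :=
  (Fin k → Dataset X n → ℝ) → Dataset X n → MeasureTheory.ProbabilityMeasure (Fin k → ℝ)

end QueryRelease

/-!
The algorithm adds to `f(D)` a noise vector `x ∈ ℝ^k` of bounded support, drawn with density
proportional to
`exp (-a * ‖x‖) * ∏ i, (R ^ 2 - x i ^ 2) ^ 2` on the cube `‖x‖ ≤ R - b`,
where `‖·‖` is the sup norm. With `L = log (1 / δ)` the parameters are `a = ε / 2`,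
`b = 50 * L / ε` and `R = 200 * √((k + L) * L) / ε ≥ 4 * b`. Since the noise never exceeds `R`, the
error bound is immediate, and only privacy is at stake: for a shift `v` with `‖v‖ ≤ 1`, the density
at `x` must be at most `e ^ ε` times the density at `x + v`, outside a set of mass at most `δ`.

The factor `exp (-a * ‖x‖)` costs `ε / 2` under any such shift, and in return it makes the edge of
the cube rare. Compared with the cube of radius `R - 2 * b`, the product weight of the cube of
radius `R - b` is larger only by a factor `exp (O(k * b ^ 3 / R ^ 3)) = exp (O(L))`, because
`(R ^ 2 - x ^ 2) ^ 2` vanishes to second order at `±R`; the exponential factor gains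
`exp (-a * (b - 1))`, which beats this. So the points that a shift may move out of the cube have
mass at most `e ^ (-2L)` (`setLIntegral_cubeNoise_shell_le`).

The product factor costs at most `ε / 2` outside a set of mass `e ^ (-2L)`
(`setLIntegral_cubeNoise_loss_le`). This is a Chernoff bound at `lam = 6 * L / ε`. As `lam = O(b)`
and points of the cube keep the distance `b` from `±R`, the exponential moment of the privacy loss
in one coordinate, `(h x / h (x + v)) ^ lam` for `h = coordDensity R`, is at most
`1 + (odd function of x) + O(lam ^ 2 R ^ 2 / (R ^ 2 - x ^ 2) ^ 2)` (`exists_log_ratio_bound`). After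
multiplication by `h` the last term is a constant, and the odd one integrates to zero over every
symmetric interval. Hence the exponential moment is at most `exp (O(lam ^ 2 / R ^ 2))` per
coordinate (`integral_tiltedPoly_le`), on every cube centred at the origin. The factor
`exp (-a * ‖x‖)` destroys independence of the coordinates, but it is a superposition of indicators
of such cubes, so the bound for cubes passes to the noise (`setLIntegral_exp_norm_mul_le`).
-/

open MeasureTheory
open scoped ENNReal

namespace QueryRelease

/-! ### The one-coordinate density and its privacy loss -/

/-- The unnormalized density of one coordinate of the noise, intended for `|x| ≤ R`. -/
def coordDensity (R x : ℝ) : ℝ := (R ^ 2 - x ^ 2) ^ 2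

/-- A polynomial upper bound for the density `h = coordDensity R` tilted by the privacy loss of the
shift `v`, that is, for `h x * (h x / h (x + v)) ^ lam`. It is the sum of `h`, an odd function of
`x`, and a constant. -/
def tiltedPoly (R lam v x : ℝ) : ℝ :=
  (R ^ 2 - x ^ 2) ^ 2 + 4 * lam * v * x * (R ^ 2 - x ^ 2) + 86 * lam ^ 2 * R ^ 2

lemma tiltedPoly_nonneg {R lam v x : ℝ} (hv : |v| ≤ 1) (hx : |x| ≤ R) :
    0 ≤ tiltedPoly R lam v x := by
  have hvx : (v * x) ^ 2 ≤ R ^ 2 := by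
    rw [← sq_abs, abs_mul]
    have : |v| * |x| ≤ 1 * R := mul_le_mul hv hx (abs_nonneg _) zero_le_one
    nlinarith [mul_nonneg (abs_nonneg v) (abs_nonneg x)]
  unfold tiltedPoly
  nlinarith [sq_nonneg (R ^ 2 - x ^ 2 + 2 * lam * (v * x)),
    mul_le_mul_of_nonneg_left hvx (sq_nonneg lam), mul_nonneg (sq_nonneg lam) (sq_nonneg R)]

lemma one_le_one_sub_mul_exp {s : ℝ} (hs : |s| ≤ 1 / 2) :
    1 ≤ (1 - s) * Real.exp (s + 2 * s ^ 2) := by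
  obtain ⟨h1, h2⟩ := abs_le.1 hs
  have hp : 0 < 1 - s := by linarith
  have hl := Real.one_sub_inv_le_log_of_pos hp
  have hb : -(s + 2 * s ^ 2) ≤ 1 - (1 - s)⁻¹ := by
    have : (1 - s)⁻¹ ≤ 1 + s + 2 * s ^ 2 := by
      rw [inv_le_iff_one_le_mul₀ hp]
      nlinarith [mul_nonneg (sq_nonneg s) (by linarith : 0 ≤ 1 - 2 * s)]
    linarith
  calc (1 : ℝ) = Real.exp (Real.log (1 - s) + -Real.log (1 - s)) := by simp
    _ ≤ Real.exp (Real.log (1 - s) + (s + 2 * s ^ 2)) := by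
        apply Real.exp_le_exp.2; linarith
    _ = _ := by rw [Real.exp_add, Real.exp_log hp]

/-- A second-order bound on `exp (p + q)` in which `p` enters to first order only through itself, so
that it can cancel by symmetry, while `q` is already of second order. -/
lemma exp_odd_add_le {p q A : ℝ} (hq0 : 0 ≤ q) (hq1 : q ≤ 1 / 2) (hp1 : |p| ≤ 1 / 2)
    (hp2 : 2 * p ^ 2 + 3 * q ≤ A) : Real.exp (p + q) ≤ 1 + p + A := by
  have hz : |p + q| ≤ 1 := by
    have := abs_add_le p q
    rw [abs_of_nonneg hq0] at this; linarith
  have hexp := (abs_le.1 (Real.abs_exp_sub_one_sub_id_le hz)).2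
  have h2 : (p + q) ^ 2 ≤ 2 * p ^ 2 + 2 * q := by nlinarith [sq_nonneg (p - q)]
  linarith

/-- The analytic core of `exists_log_ratio_bound`, with `u` in the place of `R ^ 2 - x ^ 2`. The
exponent splits into a part linear in `x * v` and a remainder of order `lam * (R / u) ^ 2`. -/
lemma sq_mul_exp_le_tilted {R b lam v x u : ℝ} (hb : 25 ≤ b) (hR : 0 < R) (hlam : 1 ≤ lam)
    (hlb : 8 * lam ≤ b) (hub : R * b ≤ u) (huR : u ≤ R ^ 2) (hxv : |v * x| ≤ R)
    (hv2 : v ^ 2 ≤ 1) (hdR : |2 * x * v + v ^ 2| ≤ 2 * R) :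
    u ^ 2 * Real.exp (lam * (2 * ((2 * x * v + v ^ 2) / u + 2 * ((2 * x * v + v ^ 2) / u) ^ 2))) ≤
      u ^ 2 + 4 * lam * v * x * u + 86 * lam ^ 2 * R ^ 2 := by
  have hupos : 0 < u := lt_of_lt_of_le (by positivity) hub
  have hlam0 : 0 < lam := by linarith
  -- all quantities are compared with powers of `z = R / u`, which is at most `1 / b`
  obtain ⟨z, hz⟩ : ∃ z, z = R / u := ⟨_, rfl⟩
  have hz0 : 0 ≤ z := by rw [hz]; positivity
  have hzu : z * u = R := by rw [hz]; field_simp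
  have hzb : z * b ≤ 1 := by
    rw [hz, div_mul_eq_mul_div, div_le_one hupos]; exact hub
  have hz25 : z ≤ 1 / 25 := by nlinarith
  have hlz : lam * z ≤ 1 / 8 := by nlinarith
  have hw : v ^ 2 / u ≤ z ^ 2 := by
    rw [hz, div_pow, div_le_div_iff₀ hupos (by positivity)]; nlinarith [sq_nonneg v]
  have hs2 : ((2 * x * v + v ^ 2) / u) ^ 2 ≤ 4 * z ^ 2 := by
    rw [hz, div_pow, div_pow, ← mul_div_assoc]
    gcongr
    rw [← sq_abs]
    calc |2 * x * v + v ^ 2| ^ 2 ≤ (2 * R) ^ 2 := by gcongr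
      _ = 4 * R ^ 2 := by ring
  have hq0 : 0 ≤ 2 * lam * (v ^ 2 / u + 2 * ((2 * x * v + v ^ 2) / u) ^ 2) := by positivity
  have hqw : 2 * lam * (v ^ 2 / u + 2 * ((2 * x * v + v ^ 2) / u) ^ 2) ≤ 18 * lam * z ^ 2 := by
    calc _ ≤ 2 * lam * (z ^ 2 + 2 * (4 * z ^ 2)) := by gcongr
      _ = _ := by ring
  have hpw : |4 * lam * (v * x / u)| ≤ 4 * (lam * z) := by
    rw [abs_mul, abs_div, abs_of_pos hupos, abs_of_pos (by linarith : 0 < 4 * lam),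
      mul_assoc, hz]
    gcongr
  have hp2 : (4 * lam * (v * x / u)) ^ 2 ≤ 16 * (lam ^ 2 * z ^ 2) := by
    rw [← sq_abs]
    calc _ ≤ (4 * (lam * z)) ^ 2 := by gcongr
      _ = _ := by ring
  have hlz2 : lam * z ^ 2 ≤ 1 / 8 * (1 / 25) := by
    rw [sq, ← mul_assoc]; exact mul_le_mul hlz hz25 hz0 (by norm_num)
  have hll : lam * z ^ 2 ≤ lam ^ 2 * z ^ 2 := by
    gcongr; nlinarith
  have hfin := exp_odd_add_le (A := 86 * (lam ^ 2 * z ^ 2)) hq0 (by linarith)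
    (hpw.trans (by linarith)) (by linarith)
  have hpq : lam * (2 * ((2 * x * v + v ^ 2) / u + 2 * ((2 * x * v + v ^ 2) / u) ^ 2)) =
      4 * lam * (v * x / u) + 2 * lam * (v ^ 2 / u + 2 * ((2 * x * v + v ^ 2) / u) ^ 2) := by ring
  rw [hpq]
  calc _ ≤ u ^ 2 * (1 + 4 * lam * (v * x / u) + 86 * (lam ^ 2 * z ^ 2)) := by gcongr
    _ = u ^ 2 + 4 * lam * v * x * u + 86 * lam ^ 2 * R ^ 2 := by
      rw [← hzu]; field_simp

/-- There is an upper bound `g` for the privacy loss `log (h x / h (x + v))` of one coordinate,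
`h = coordDensity R`, whose exponential moment is controlled by `tiltedPoly`. -/
lemma exists_log_ratio_bound {R b lam v x : ℝ} (hb : 25 ≤ b) (hbR : b ≤ R) (hlam : 1 ≤ lam)
    (hlb : 8 * lam ≤ b) (hv : |v| ≤ 1) (hx : |x| ≤ R - b) :
    ∃ g : ℝ, coordDensity R x ≤ coordDensity R (x + v) * Real.exp g ∧
      coordDensity R x * Real.exp (lam * g) ≤ tiltedPoly R lam v x := by
  have hR : 0 < R := by linarith
  have hub : R * b ≤ R ^ 2 - x ^ 2 := by rw [← sq_abs x]; nlinarith [abs_nonneg x]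
  have hupos : 0 < R ^ 2 - x ^ 2 := lt_of_lt_of_le (by positivity) hub
  have huR : R ^ 2 - x ^ 2 ≤ R ^ 2 := by nlinarith [sq_nonneg x]
  have hv2 : v ^ 2 ≤ 1 := by rw [← sq_abs]; nlinarith [abs_nonneg v]
  have hxv : |v * x| ≤ R - b := by
    rw [abs_mul]; nlinarith [abs_nonneg x, abs_nonneg v]
  have hdR : |2 * x * v + v ^ 2| ≤ 2 * R := by
    rw [abs_le]; obtain ⟨h1, h2⟩ := abs_le.1 hxv
    constructor <;> nlinarith [sq_nonneg v]
  refine ⟨_, ?_, sq_mul_exp_le_tilted hb hR hlam hlb hub huR (by linarith) hv2 hdR⟩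
  -- `R ^ 2 - (x + v) ^ 2` is `R ^ 2 - x ^ 2` times `1 - s`
  obtain ⟨s, hs⟩ : ∃ s, s = (2 * x * v + v ^ 2) / (R ^ 2 - x ^ 2) := ⟨_, rfl⟩
  have hsu : s * (R ^ 2 - x ^ 2) = 2 * x * v + v ^ 2 := by rw [hs]; field_simp
  have hshalf : |s| ≤ 1 / 2 := by
    rw [hs, abs_div, abs_of_pos hupos, div_le_iff₀ hupos]; nlinarith
  have he : R ^ 2 - (x + v) ^ 2 = (R ^ 2 - x ^ 2) * (1 - s) := by linear_combination hsu
  have : coordDensity R (x + v) * Real.exp (2 * (s + 2 * s ^ 2))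
      = (R ^ 2 - x ^ 2) ^ 2 * ((1 - s) * Real.exp (s + 2 * s ^ 2)) ^ 2 := by
    rw [coordDensity, he, two_mul, Real.exp_add]; ring
  rw [← hs, this, coordDensity]
  exact le_mul_of_one_le_right (sq_nonneg _) (one_le_pow₀ (one_le_one_sub_mul_exp hshalf))

lemma integral_coordDensity (R t : ℝ) :
    ∫ x in -t..t, coordDensity R x = 2 * t * R ^ 4 - 4 / 3 * R ^ 2 * t ^ 3 + 2 / 5 * t ^ 5 := by
  have : ∀ x : ℝ, coordDensity R x = R ^ 4 - 2 * R ^ 2 * x ^ 2 + x ^ 4 := fun x => by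
    unfold coordDensity; ring
  simp only [this]
  rw [intervalIntegral.integral_add, intervalIntegral.integral_sub,
    intervalIntegral.integral_const_mul, integral_pow, integral_pow]
  · simp; ring
  all_goals exact Continuous.intervalIntegrable (by fun_prop) _ _

lemma integral_tiltedPoly (R lam v t : ℝ) :
    ∫ x in -t..t, tiltedPoly R lam v x =
      (∫ x in -t..t, coordDensity R x) + 172 * lam ^ 2 * R ^ 2 * t := by
  have : ∀ x : ℝ, tiltedPoly R lam v x = coordDensity R x +
      ((4 * lam * v * R ^ 2) * x ^ 1 - (4 * lam * v) * x ^ 3 + 86 * lam ^ 2 * R ^ 2) := fun x => by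
    unfold tiltedPoly coordDensity; ring
  simp only [this]
  rw [intervalIntegral.integral_add, intervalIntegral.integral_add, intervalIntegral.integral_sub,
    intervalIntegral.integral_const_mul, intervalIntegral.integral_const_mul, integral_pow,
    integral_pow]
  · simp; ring
  all_goals
    refine Continuous.intervalIntegrable ?_ _ _
    first | fun_prop | (unfold coordDensity; fun_prop)

lemma le_integral_coordDensity {R t : ℝ} (ht : 0 ≤ t) (htR : t ≤ R) :
    2 / 3 * t * R ^ 4 ≤ ∫ x in -t..t, coordDensity R x := by
  rw [integral_coordDensity]
  have h1 : t ^ 2 ≤ R ^ 2 := by gcongr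
  have h2 : R ^ 2 * t * t ^ 2 ≤ R ^ 2 * t * R ^ 2 := by gcongr
  have h3 : 0 ≤ t ^ 5 := by positivity
  nlinarith

lemma integral_tiltedPoly_le {R lam v t : ℝ} (hR : 0 < R) (ht : 0 ≤ t) (htR : t ≤ R) :
    ∫ x in -t..t, tiltedPoly R lam v x ≤
      Real.exp (258 * (lam ^ 2 / R ^ 2)) * ∫ x in -t..t, coordDensity R x := by
  have h := le_integral_coordDensity ht htR
  have he := Real.add_one_le_exp (258 * (lam ^ 2 / R ^ 2))
  have h0 : 0 ≤ ∫ x in -t..t, coordDensity R x := le_trans (by positivity) h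
  have h2 : 258 * (lam ^ 2 / R ^ 2) * (2 / 3 * t * R ^ 4) = 172 * lam ^ 2 * R ^ 2 * t := by
    field_simp; ring
  rw [integral_tiltedPoly, ← h2]
  calc _ ≤ (∫ x in -t..t, coordDensity R x)
          + 258 * (lam ^ 2 / R ^ 2) * ∫ x in -t..t, coordDensity R x := by gcongr
    _ = (258 * (lam ^ 2 / R ^ 2) + 1) * ∫ x in -t..t, coordDensity R x := by ring
    _ ≤ _ := by gcongr

/-- The layer `R - 2 * b ≤ |x| ≤ R - b` carries only a fraction `O(b ^ 3 / R ^ 3)` of the mass, as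
the density vanishes to second order at `±R`. -/
lemma integral_coordDensity_shrink {R b : ℝ} (hb : 0 < b) (hbR : 4 * b ≤ R) :
    ∫ x in -(R - b)..(R - b), coordDensity R x ≤
      Real.exp (192 * (b ^ 3 / R ^ 3)) * ∫ x in -(R - 2 * b)..(R - 2 * b), coordDensity R x := by
  have hR : 0 < R := by linarith
  have h := le_integral_coordDensity (R := R) (t := R - 2 * b) (by linarith) (by linarith)
  have he := Real.add_one_le_exp (192 * (b ^ 3 / R ^ 3))
  have h3 : R ^ 5 / 3 ≤ ∫ x in -(R - 2 * b)..(R - 2 * b), coordDensity R x := by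
    refine le_trans ?_ h
    have : R ^ 5 / 3 = 2 / 3 * (R / 2) * R ^ 4 := by ring
    rw [this]; gcongr; linarith
  have hdiff : ∫ x in -(R - b)..(R - b), coordDensity R x ≤
      (∫ x in -(R - 2 * b)..(R - 2 * b), coordDensity R x) + 64 * R ^ 2 * b ^ 3 := by
    rw [integral_coordDensity, integral_coordDensity]
    have h1 : 0 ≤ R * b ^ 4 := by positivity
    have h2 : b ^ 5 ≤ R * b ^ 4 := by
      have : b ≤ R := by linarith
      calc b ^ 5 = b * b ^ 4 := by ring
        _ ≤ R * b ^ 4 := by gcongr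
    have h4 : R * b ^ 4 * 4 ≤ R ^ 2 * b ^ 3 := by
      calc R * b ^ 4 * 4 = R * b ^ 3 * (4 * b) := by ring
        _ ≤ R * b ^ 3 * R := by gcongr
        _ = _ := by ring
    nlinarith
  have h2 : 192 * (b ^ 3 / R ^ 3) * (R ^ 5 / 3) = 64 * R ^ 2 * b ^ 3 := by
    field_simp; ring
  calc _ ≤ _ := hdiff
    _ ≤ (∫ x in -(R - 2 * b)..(R - 2 * b), coordDensity R x)
          + 192 * (b ^ 3 / R ^ 3) * ∫ x in -(R - 2 * b)..(R - 2 * b), coordDensity R x := by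
        rw [← h2]; gcongr
    _ = (192 * (b ^ 3 / R ^ 3) + 1) * ∫ x in -(R - 2 * b)..(R - 2 * b), coordDensity R x := by ring
    _ ≤ _ := by
        gcongr
        exact le_trans (by positivity) h3

/-! ### Integrals over cubes and the exponential of the sup norm -/

variable {ι : Type*} [Fintype ι]

lemma continuous_coordDensity (R : ℝ) : Continuous (coordDensity R) := by
  unfold coordDensity; fun_prop

lemma continuous_tiltedPoly (R lam v : ℝ) : Continuous (tiltedPoly R lam v) := by
  unfold tiltedPoly; fun_prop

lemma coordDensity_nonneg (R x : ℝ) : 0 ≤ coordDensity R x := sq_nonneg _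

lemma setLIntegral_closedBall_prod {t : ℝ} (ht : 0 ≤ t) {q : ι → ℝ → ℝ}
    (hq : ∀ i, Continuous (q i)) (hq0 : ∀ i x, |x| ≤ t → 0 ≤ q i x) :
    ∫⁻ x in Metric.closedBall (0 : ι → ℝ) t, ENNReal.ofReal (∏ i, q i (x i)) =
      ENNReal.ofReal (∏ i, ∫ x in -t..t, q i x) := by
  have hball : Metric.closedBall (0 : ι → ℝ) t = Set.univ.pi fun _ => Set.Icc (-t) t := by
    rw [closedBall_pi _ ht]
    exact Set.pi_congr rfl fun i _ => by simp [Real.closedBall_eq_Icc]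
  have hpi : (volume : Measure (ι → ℝ)).restrict (Metric.closedBall 0 t) =
      Measure.pi fun _ => (volume : Measure ℝ).restrict (Set.Icc (-t) t) := by
    rw [hball, volume_pi, Measure.restrict_pi_pi]
  have hint : ∀ i, Integrable (q i) (volume.restrict (Set.Icc (-t) t)) := fun i =>
    (hq i).continuousOn.integrableOn_Icc
  have h0 : 0 ≤ᵐ[volume.restrict (Metric.closedBall (0 : ι → ℝ) t)] fun x => ∏ i, q i (x i) := by
    filter_upwards [ae_restrict_mem Metric.isClosed_closedBall.measurableSet] with x hx
    refine Finset.prod_nonneg fun i _ => hq0 i _ ?_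
    exact (norm_le_pi_norm x i).trans (mem_closedBall_zero_iff.1 hx)
  rw [← ofReal_integral_eq_lintegral_ofReal _ h0]
  · rw [hpi, integral_fintype_prod_eq_prod]
    congr! 2 with i
    rw [intervalIntegral.integral_of_le (by linarith), integral_Icc_eq_integral_Ioc]
  · rw [hpi]
    exact Integrable.fintype_prod hint

lemma ofReal_exp_eq_lintegral_Ici {a : ℝ} (ha : 0 < a) (s : ℝ) :
    ENNReal.ofReal (Real.exp (-(a * s))) =
      ∫⁻ t in Set.Ici s, ENNReal.ofReal (a * Real.exp (-a * t)) := by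
  have hi : IntegrableOn (fun t : ℝ => Real.exp (-a * t)) (Set.Ioi s) :=
    integrableOn_exp_mul_Ioi (by linarith) s
  rw [setLIntegral_congr (Ioi_ae_eq_Ici (a := s)).symm,
    ← ofReal_integral_eq_lintegral_ofReal (hi.const_mul a)
      (Filter.Eventually.of_forall fun t => by positivity),
    integral_const_mul, integral_exp_mul_Ioi (by linarith)]
  congr 1
  field_simp

/-- Layer-cake formula: `exp (-a * ‖x‖)` is the superposition, with weights `a * exp (-a * t)`, of
the indicators of the balls `‖x‖ ≤ t`. -/
lemma setLIntegral_exp_norm_mul {E : Type*} [NormedAddCommGroup E] [MeasurableSpace E]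
    [OpensMeasurableSpace E] [SecondCountableTopology E] (μ : Measure E) [SFinite μ]
    {a : ℝ} (ha : 0 < a) (T : ℝ) {Q : E → ℝ≥0∞} (hQ : Measurable Q) :
    ∫⁻ x in Metric.closedBall 0 T, ENNReal.ofReal (Real.exp (-(a * ‖x‖))) * Q x ∂μ =
      ∫⁻ t : ℝ, ENNReal.ofReal (a * Real.exp (-a * t)) *
        ∫⁻ x in Metric.closedBall 0 (min t T), Q x ∂μ := by
  have hS : MeasurableSet {p : E × ℝ | ‖p.1‖ ≤ p.2} :=
    measurableSet_le (by fun_prop) (by fun_prop)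
  have h1 : ∀ x : E, ENNReal.ofReal (Real.exp (-(a * ‖x‖))) * Q x =
      ∫⁻ t : ℝ, {p : E × ℝ | ‖p.1‖ ≤ p.2}.indicator
        (fun p => ENNReal.ofReal (a * Real.exp (-a * p.2)) * Q p.1) (x, t) := fun x => by
    rw [ofReal_exp_eq_lintegral_Ici ha, ← lintegral_mul_const _ (by fun_prop),
      ← lintegral_indicator measurableSet_Ici]
    rfl
  simp_rw [h1]
  rw [lintegral_lintegral_swap]
  · congr! 2 with t
    rw [← lintegral_const_mul _ hQ, ← lintegral_indicator Metric.isClosed_closedBall.measurableSet,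
      ← lintegral_indicator Metric.isClosed_closedBall.measurableSet]
    congr! 2 with x
    by_cases hx1 : ‖x‖ ≤ t <;> by_cases hx2 : ‖x‖ ≤ T <;> simp [Set.indicator, hx1, hx2]
  · refine (Measurable.indicator ?_ hS).aemeasurable
    exact Measurable.mul (by fun_prop) (hQ.comp measurable_fst)

/-- A comparison of two integrals over all balls centred at the origin persists when both integrands
are multiplied by `exp (-a * ‖x‖)`. -/
lemma setLIntegral_exp_norm_mul_le {E : Type*} [NormedAddCommGroup E] [MeasurableSpace E]
    [OpensMeasurableSpace E] [SecondCountableTopology E] (μ : Measure E) [SFinite μ]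
    {a : ℝ} (ha : 0 < a) {T : ℝ} {Q H : E → ℝ≥0∞} (hQ : Measurable Q) (hH : Measurable H)
    {c : ℝ≥0∞} (h : ∀ t, 0 ≤ t → t ≤ T → ∫⁻ x in Metric.closedBall 0 t, Q x ∂μ ≤
      c * ∫⁻ x in Metric.closedBall 0 t, H x ∂μ) :
    ∫⁻ x in Metric.closedBall 0 T, ENNReal.ofReal (Real.exp (-(a * ‖x‖))) * Q x ∂μ ≤
      c * ∫⁻ x in Metric.closedBall 0 T, ENNReal.ofReal (Real.exp (-(a * ‖x‖))) * H x ∂μ := by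
  have hle : ∀ t, ∫⁻ x in Metric.closedBall 0 (min t T), Q x ∂μ ≤
      c * ∫⁻ x in Metric.closedBall 0 (min t T), H x ∂μ := fun t => by
    rcases lt_or_ge (min t T) 0 with ht | ht
    · simp [Metric.closedBall_eq_empty.2 ht]
    · exact h _ ht (min_le_right _ _)
  have hmono : Monotone fun t : ℝ => ∫⁻ x in Metric.closedBall 0 (min t T), H x ∂μ :=
    fun s t hst => lintegral_mono_set (Metric.closedBall_subset_closedBall (by gcongr))
  rw [setLIntegral_exp_norm_mul μ ha T hQ, setLIntegral_exp_norm_mul μ ha T hH,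
    ← lintegral_const_mul c (show Measurable fun t : ℝ => ENNReal.ofReal (a * Real.exp (-a * t)) *
      ∫⁻ x in Metric.closedBall 0 (min t T), H x ∂μ from
        Measurable.mul (by fun_prop) hmono.measurable)]
  refine lintegral_mono fun t => ?_
  calc _ ≤ ENNReal.ofReal (a * Real.exp (-a * t)) *
        (c * ∫⁻ x in Metric.closedBall 0 (min t T), H x ∂μ) := by gcongr; exact hle t
    _ = _ := by ring

/-! ### The noise density -/

/-- The unnormalized density of the noise vector, `exp (-a * ‖x‖) * ∏ i, (R ^ 2 - x i ^ 2) ^ 2` on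
the cube `‖x‖ ≤ T` and zero outside. It is meant for `T ≤ R`. -/
noncomputable def cubeNoise (a R T : ℝ) : (ι → ℝ) → ℝ≥0∞ :=
  (Metric.closedBall 0 T).indicator fun x =>
    ENNReal.ofReal (Real.exp (-(a * ‖x‖))) * ENNReal.ofReal (∏ i, coordDensity R (x i))

lemma measurable_prod_coordDensity (R : ℝ) :
    Measurable fun x : ι → ℝ => ENNReal.ofReal (∏ i, coordDensity R (x i)) := by
  have := continuous_coordDensity R
  fun_prop

lemma measurable_cubeNoise (a R T : ℝ) : Measurable (cubeNoise (ι := ι) a R T) :=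
  Measurable.indicator (Measurable.mul (by fun_prop) (measurable_prod_coordDensity R))
    Metric.isClosed_closedBall.measurableSet

lemma cubeNoise_of_mem {a R T : ℝ} {x : ι → ℝ} (hx : ‖x‖ ≤ T) : cubeNoise a R T x =
    ENNReal.ofReal (Real.exp (-(a * ‖x‖))) * ENNReal.ofReal (∏ i, coordDensity R (x i)) :=
  Set.indicator_of_mem (mem_closedBall_zero_iff.2 hx) _

lemma cubeNoise_of_lt {a R T : ℝ} {x : ι → ℝ} (hx : T < ‖x‖) : cubeNoise a R T x = 0 :=
  Set.indicator_of_notMem (by simpa using hx) _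

lemma lintegral_cubeNoise (a R T : ℝ) : ∫⁻ x : ι → ℝ, cubeNoise a R T x =
    ∫⁻ x in Metric.closedBall (0 : ι → ℝ) T, ENNReal.ofReal (Real.exp (-(a * ‖x‖))) *
      ENNReal.ofReal (∏ i, coordDensity R (x i)) :=
  lintegral_indicator Metric.isClosed_closedBall.measurableSet _

lemma ofReal_mul_prod_integral_le_lintegral_cubeNoise {a R T t : ℝ} (ha : 0 ≤ a) (ht : 0 ≤ t)
    (htT : t ≤ T) :
    ENNReal.ofReal (Real.exp (-(a * t)) *
      (∫ x in -t..t, coordDensity R x) ^ Fintype.card ι) ≤ ∫⁻ x : ι → ℝ, cubeNoise a R T x := by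
  rw [lintegral_cubeNoise, ENNReal.ofReal_mul (Real.exp_pos _).le]
  have h := setLIntegral_closedBall_prod (ι := ι) ht (fun _ => continuous_coordDensity R)
    (fun _ x _ => coordDensity_nonneg R x)
  rw [Finset.prod_const, Finset.card_univ] at h
  rw [← h, ← lintegral_const_mul _ (measurable_prod_coordDensity R)]
  refine (setLIntegral_mono' Metric.isClosed_closedBall.measurableSet fun x hx => ?_).trans
    (lintegral_mono_set (Metric.closedBall_subset_closedBall htT))
  gcongr
  exact mem_closedBall_zero_iff.1 hx

lemma setLIntegral_cubeNoise_le {a R T t : ℝ} (ha : 0 ≤ a) (hT : 0 ≤ T) :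
    ∫⁻ x in {x : ι → ℝ | t < ‖x‖}, cubeNoise a R T x ≤ ENNReal.ofReal (Real.exp (-(a * t)) *
      (∫ x in -T..T, coordDensity R x) ^ Fintype.card ι) := by
  have h := setLIntegral_closedBall_prod (ι := ι) hT (fun _ => continuous_coordDensity R)
    (fun _ x _ => coordDensity_nonneg R x)
  rw [Finset.prod_const, Finset.card_univ] at h
  rw [ENNReal.ofReal_mul (Real.exp_pos _).le, ← h,
    ← lintegral_const_mul _ (measurable_prod_coordDensity R),
    ← lintegral_indicator Metric.isClosed_closedBall.measurableSet]
  refine (setLIntegral_mono' (measurableSet_lt (by fun_prop) (by fun_prop)) fun x hx => ?_).trans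
    (setLIntegral_le_lintegral _ _)
  refine Set.indicator_le_indicator ?_
  gcongr
  exact le_of_lt hx

lemma lintegral_cubeNoise_ne_top {a R T : ℝ} (ha : 0 ≤ a) (hT : 0 ≤ T) :
    ∫⁻ x : ι → ℝ, cubeNoise a R T x ≠ ∞ := by
  have h := setLIntegral_cubeNoise_le (ι := ι) (R := R) (t := -1) ha hT
  have hu : {x : ι → ℝ | (-1 : ℝ) < ‖x‖} = Set.univ :=
    Set.eq_univ_of_forall fun x => (by norm_num : (-1 : ℝ) < 0).trans_le (norm_nonneg x)
  rw [hu, setLIntegral_univ] at h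
  exact ne_top_of_le_ne_top ENNReal.ofReal_ne_top h

lemma lintegral_cubeNoise_ne_zero {a R T : ℝ} (ha : 0 ≤ a) (hT : 0 < T) (hTR : T ≤ R) :
    ∫⁻ x : ι → ℝ, cubeNoise a R T x ≠ 0 := by
  refine (lt_of_lt_of_le ?_
    (ofReal_mul_prod_integral_le_lintegral_cubeNoise (R := R) ha hT.le le_rfl)).ne'
  have hR : 0 < R := hT.trans_le hTR
  have : 0 < ∫ x in -T..T, coordDensity R x :=
    lt_of_lt_of_le (by positivity) (le_integral_coordDensity hT.le hTR)
  exact ENNReal.ofReal_pos.2 (by positivity)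

/-- The part of the cube that a shift of length `1` can move out of the cube has small mass. The cube
of radius `R - 2 * b` serves as the reference: there `exp (-a * ‖x‖)` is larger by the factor
`exp (a * (b - 1))`. -/
lemma setLIntegral_cubeNoise_shell_le {a R b : ℝ} (ha : 0 ≤ a) (hb : 0 < b) (hbR : 4 * b ≤ R) :
    ∫⁻ x in {x : ι → ℝ | R - b - 1 < ‖x‖}, cubeNoise a R (R - b) x ≤
      ENNReal.ofReal (Real.exp (Fintype.card ι * (192 * (b ^ 3 / R ^ 3)) - a * (b - 1))) *
        ∫⁻ x : ι → ℝ, cubeNoise a R (R - b) x := by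
  have h0 : 0 ≤ ∫ x in -(R - b)..(R - b), coordDensity R x :=
    le_trans (by have : 0 ≤ R - b := by linarith
                 positivity)
      (le_integral_coordDensity (R := R) (t := R - b) (by linarith) (by linarith))
  calc _ ≤ ENNReal.ofReal (Real.exp (-(a * (R - b - 1))) *
          (∫ x in -(R - b)..(R - b), coordDensity R x) ^ Fintype.card ι) :=
        setLIntegral_cubeNoise_le ha (by linarith)
    _ ≤ ENNReal.ofReal (Real.exp (-(a * (R - b - 1))) * (Real.exp (192 * (b ^ 3 / R ^ 3)) *
          ∫ x in -(R - 2 * b)..(R - 2 * b), coordDensity R x) ^ Fintype.card ι) := by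
        gcongr
        exact integral_coordDensity_shrink hb hbR
    _ = ENNReal.ofReal (Real.exp (Fintype.card ι * (192 * (b ^ 3 / R ^ 3)) - a * (b - 1))) *
          ENNReal.ofReal (Real.exp (-(a * (R - 2 * b))) *
            (∫ x in -(R - 2 * b)..(R - 2 * b), coordDensity R x) ^ Fintype.card ι) := by
        have hexp : Real.exp (-(a * (R - b - 1))) *
            Real.exp (Fintype.card ι * (192 * (b ^ 3 / R ^ 3))) =
            Real.exp (Fintype.card ι * (192 * (b ^ 3 / R ^ 3)) - a * (b - 1)) *
            Real.exp (-(a * (R - 2 * b))) := by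
          rw [← Real.exp_add, ← Real.exp_add]; ring_nf
        rw [← ENNReal.ofReal_mul (Real.exp_pos _).le, mul_pow, ← Real.exp_nat_mul, ← mul_assoc,
          hexp, mul_assoc]
    _ ≤ _ := by
        gcongr
        exact ofReal_mul_prod_integral_le_lintegral_cubeNoise ha (by linarith) (by linarith)

/-- Chernoff bound: the set where the product factor of the density drops by more than `exp (-κ)`
under the shift `v` has small mass. -/
lemma setLIntegral_cubeNoise_loss_le {a R b lam κ : ℝ} (ha : 0 < a) (hb : 25 ≤ b) (hbR : b ≤ R)
    (hlam : 1 ≤ lam) (hlb : 8 * lam ≤ b) {v : ι → ℝ} (hv : ∀ i, |v i| ≤ 1) :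
    ∫⁻ x in {x : ι → ℝ | Real.exp κ * ∏ i, coordDensity R (x i + v i) <
        ∏ i, coordDensity R (x i)}, cubeNoise a R (R - b) x ≤
      ENNReal.ofReal (Real.exp (Fintype.card ι * (258 * (lam ^ 2 / R ^ 2)) - lam * κ)) *
        ∫⁻ x : ι → ℝ, cubeNoise a R (R - b) x := by
  have hR : 0 < R := by linarith
  have hcd := continuous_coordDensity R
  have hct := fun i => continuous_tiltedPoly R lam (v i)
  have hQm : Measurable fun x : ι → ℝ => ENNReal.ofReal (∏ i, tiltedPoly R lam (v i) (x i)) := by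
    fun_prop
  -- Markov's inequality, in pointwise form
  have hpt : ∀ x : ι → ℝ, Real.exp κ * ∏ i, coordDensity R (x i + v i) <
      ∏ i, coordDensity R (x i) → cubeNoise a R (R - b) x ≤
      (Metric.closedBall 0 (R - b)).indicator (fun x => ENNReal.ofReal (Real.exp (-(lam * κ))) *
        (ENNReal.ofReal (Real.exp (-(a * ‖x‖))) *
          ENNReal.ofReal (∏ i, tiltedPoly R lam (v i) (x i)))) x := by
    intro x hx
    rcases lt_or_ge (R - b) ‖x‖ with hxT | hxT
    · rw [cubeNoise_of_lt hxT]; exact zero_le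
    rw [cubeNoise_of_mem hxT, Set.indicator_of_mem (mem_closedBall_zero_iff.2 hxT),
      mul_left_comm, ← ENNReal.ofReal_mul (p := Real.exp (-(lam * κ))) (Real.exp_pos _).le]
    gcongr
    choose g hg1 hg2 using fun i => exists_log_ratio_bound hb hbR hlam hlb (hv i)
      ((norm_le_pi_norm x i).trans hxT)
    have hprod1 : ∏ i, coordDensity R (x i) ≤
        (∏ i, coordDensity R (x i + v i)) * Real.exp (∑ i, g i) := by
      rw [Real.exp_sum, ← Finset.prod_mul_distrib]
      exact Finset.prod_le_prod (fun i _ => coordDensity_nonneg _ _) fun i _ => hg1 i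
    have hprod2 : (∏ i, coordDensity R (x i)) * Real.exp (lam * ∑ i, g i) ≤
        ∏ i, tiltedPoly R lam (v i) (x i) := by
      rw [Finset.mul_sum, Real.exp_sum, ← Finset.prod_mul_distrib]
      exact Finset.prod_le_prod
        (fun i _ => mul_nonneg (coordDensity_nonneg _ _) (Real.exp_pos _).le) fun i _ => hg2 i
    have hκ : κ ≤ ∑ i, g i := by
      have h := hx.trans_le hprod1
      rw [mul_comm] at h
      exact (Real.exp_lt_exp.1 (lt_of_mul_lt_mul_left h
        (Finset.prod_nonneg fun i _ => coordDensity_nonneg _ _))).le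
    have h0 : 0 ≤ ∏ i, coordDensity R (x i) := Finset.prod_nonneg fun i _ => coordDensity_nonneg _ _
    calc ∏ i, coordDensity R (x i)
        = Real.exp (-(lam * κ)) * ((∏ i, coordDensity R (x i)) * Real.exp (lam * κ)) := by
          rw [mul_left_comm, ← Real.exp_add]; simp
      _ ≤ Real.exp (-(lam * κ)) * ((∏ i, coordDensity R (x i)) * Real.exp (lam * ∑ i, g i)) := by
          gcongr
      _ ≤ _ := by gcongr
  -- on a cube the coordinates are independent, so the exponential moment factorizes
  have hcube : ∀ t, 0 ≤ t → t ≤ R - b →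
      ∫⁻ x in Metric.closedBall (0 : ι → ℝ) t, ENNReal.ofReal (∏ i, tiltedPoly R lam (v i) (x i)) ≤
      ENNReal.ofReal (Real.exp (Fintype.card ι * (258 * (lam ^ 2 / R ^ 2)))) *
        ∫⁻ x in Metric.closedBall (0 : ι → ℝ) t, ENNReal.ofReal (∏ i, coordDensity R (x i)) := by
    intro t ht htT
    rw [setLIntegral_closedBall_prod ht hct
        (fun i x hx => tiltedPoly_nonneg (hv i) (hx.trans (by linarith))),
      setLIntegral_closedBall_prod ht (fun _ => hcd) (fun _ x _ => coordDensity_nonneg R x),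
      ← ENNReal.ofReal_mul (Real.exp_pos _).le, Real.exp_nat_mul, ← Finset.card_univ,
      ← Finset.prod_const, ← Finset.prod_mul_distrib]
    refine ENNReal.ofReal_le_ofReal (Finset.prod_le_prod (fun i _ => ?_) fun i _ =>
      integral_tiltedPoly_le hR ht (by linarith))
    refine intervalIntegral.integral_nonneg (by linarith) fun x hx => ?_
    exact tiltedPoly_nonneg (hv i) ((abs_le.2 hx).trans (by linarith))
  have hmeas : MeasurableSet {x : ι → ℝ | Real.exp κ * ∏ i, coordDensity R (x i + v i) <
      ∏ i, coordDensity R (x i)} :=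
    measurableSet_lt (by fun_prop) (by fun_prop)
  calc _ ≤ ∫⁻ x : ι → ℝ, (Metric.closedBall 0 (R - b)).indicator
        (fun x => ENNReal.ofReal (Real.exp (-(lam * κ))) *
        (ENNReal.ofReal (Real.exp (-(a * ‖x‖))) *
          ENNReal.ofReal (∏ i, tiltedPoly R lam (v i) (x i)))) x :=
        (setLIntegral_mono' hmeas hpt).trans (setLIntegral_le_lintegral _ _)
    _ = ENNReal.ofReal (Real.exp (-(lam * κ))) * ∫⁻ x in Metric.closedBall (0 : ι → ℝ) (R - b),
        ENNReal.ofReal (Real.exp (-(a * ‖x‖))) *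
          ENNReal.ofReal (∏ i, tiltedPoly R lam (v i) (x i)) := by
        rw [lintegral_indicator Metric.isClosed_closedBall.measurableSet,
          lintegral_const_mul _ (show Measurable fun x : ι → ℝ =>
            ENNReal.ofReal (Real.exp (-(a * ‖x‖))) *
              ENNReal.ofReal (∏ i, tiltedPoly R lam (v i) (x i)) from
            Measurable.mul (by fun_prop) hQm)]
    _ ≤ ENNReal.ofReal (Real.exp (-(lam * κ))) *
        (ENNReal.ofReal (Real.exp (Fintype.card ι * (258 * (lam ^ 2 / R ^ 2)))) *
          ∫⁻ x : ι → ℝ, cubeNoise a R (R - b) x) := by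
        rw [lintegral_cubeNoise]
        gcongr
        exact setLIntegral_exp_norm_mul_le volume ha hQm (measurable_prod_coordDensity R) hcube
    _ = _ := by
        rw [← mul_assoc, ← ENNReal.ofReal_mul (Real.exp_pos _).le, ← Real.exp_add]
        ring_nf

lemma cubeNoise_le_shift {a R T κ : ℝ} (ha : 0 ≤ a) {v x : ι → ℝ} (hv : ‖v‖ ≤ 1)
    (hx : ‖x‖ ≤ T - 1)
    (hloss : ∏ i, coordDensity R (x i) ≤ Real.exp κ * ∏ i, coordDensity R (x i + v i)) :
    cubeNoise a R T x ≤ ENNReal.ofReal (Real.exp (a + κ)) * cubeNoise a R T (x + v) := by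
  have hxv : ‖x + v‖ ≤ ‖x‖ + 1 := (norm_add_le x v).trans (by linarith)
  rw [cubeNoise_of_mem (by linarith), cubeNoise_of_mem (hxv.trans (by linarith)),
    ← ENNReal.ofReal_mul (Real.exp_pos _).le, ← ENNReal.ofReal_mul (Real.exp_pos _).le,
    ← ENNReal.ofReal_mul (Real.exp_pos _).le]
  refine ENNReal.ofReal_le_ofReal ?_
  have h0 : 0 ≤ ∏ i, coordDensity R (x i + v i) :=
    Finset.prod_nonneg fun i _ => coordDensity_nonneg _ _
  calc _ ≤ Real.exp (-(a * ‖x‖)) * (Real.exp κ * ∏ i, coordDensity R (x i + v i)) := by gcongr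
    _ = Real.exp (-(a * ‖x‖) + κ) * ∏ i, coordDensity R (x i + v i) := by
        rw [Real.exp_add]; ring
    _ ≤ Real.exp (a + κ + -(a * ‖x + v‖)) * ∏ i, coordDensity R (x i + v i) := by
        refine mul_le_mul_of_nonneg_right (Real.exp_le_exp.2 ?_) h0
        nlinarith
    _ = _ := by simp only [Real.exp_add, Pi.add_apply]; ring

/-- A density that, outside `B`, is at most `c` times its translate gives approximate
indistinguishability of the translated measures, with the mass of `B` as additive error. -/
lemma setLIntegral_le_of_shift {E : Type*} [AddCommGroup E] [MeasurableSpace E] [MeasurableAdd E]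
    (μ : Measure E) [μ.IsAddRightInvariant] {W : E → ℝ≥0∞}
    {c : ℝ≥0∞} (v : E) {B : Set E} (h : ∀ x ∉ B, W x ≤ c * W (x + v))
    {S S' : Set E} (hS : MeasurableSet S) (hS' : MeasurableSet S') (hSS : ∀ x, x ∈ S → x + v ∈ S')
    (hW : Measurable W) (hB : MeasurableSet B) :
    ∫⁻ x in S, W x ∂μ ≤ c * ∫⁻ x in S', W x ∂μ + ∫⁻ x in B, W x ∂μ := by
  rw [← lintegral_indicator hS, ← lintegral_indicator hS', ← lintegral_indicator hB,
    ← lintegral_add_right_eq_self (μ := μ) (S'.indicator W) v,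
    ← lintegral_const_mul c (show Measurable fun x => S'.indicator W (x + v) from
      (hW.indicator hS').comp (measurable_add_const v)),
    ← lintegral_add_right _ (hW.indicator hB)]
  refine lintegral_mono fun x => ?_
  by_cases hxB : x ∈ B
  · rw [Set.indicator_of_mem hxB]
    exact (Set.indicator_le_self _ _ x).trans le_add_self
  · by_cases hxS : x ∈ S
    · rw [Set.indicator_of_mem hxS, Set.indicator_of_mem (hSS x hxS)]
      exact (h x hxB).trans le_self_add
    · rw [Set.indicator_of_notMem hxS]; exact zero_le

/-! ### Adding noise of a given density -/

/-- The probability measure with density proportional to `W` with respect to `μ`. -/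
noncomputable def normalizedLaw {E : Type*} [MeasurableSpace E] (μ : Measure E) (W : E → ℝ≥0∞)
    (h0 : ∫⁻ x, W x ∂μ ≠ 0) (htop : ∫⁻ x, W x ∂μ ≠ ∞) : ProbabilityMeasure E :=
  ⟨(∫⁻ x, W x ∂μ)⁻¹ • μ.withDensity W, ⟨by
    simp [withDensity_apply _ MeasurableSet.univ, ENNReal.inv_mul_cancel h0 htop]⟩⟩

lemma normalizedLaw_apply {E : Type*} [MeasurableSpace E] {μ : Measure E} {W : E → ℝ≥0∞}
    (h0 : ∫⁻ x, W x ∂μ ≠ 0) (htop : ∫⁻ x, W x ∂μ ≠ ∞) {S : Set E} (hS : MeasurableSet S) :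
    (normalizedLaw μ W h0 htop : Measure E) S = (∫⁻ x, W x ∂μ)⁻¹ * ∫⁻ x in S, W x ∂μ := by
  change ((∫⁻ x, W x ∂μ)⁻¹ • μ.withDensity W) S = _
  rw [Measure.smul_apply, withDensity_apply _ hS, smul_eq_mul]

/-- The algorithm that answers with the true values `f i D` plus a noise vector of law `ν`. -/
noncomputable def additiveNoise {X : Type*} {n k : ℕ} (ν : ProbabilityMeasure (Fin k → ℝ)) :
    QueryAlgorithm X n k :=
  fun f D => ν.map (f := fun x => x + fun i => f i D) (measurable_add_const _).aemeasurable

lemma additiveNoise_apply {X : Type*} {n k : ℕ} (ν : ProbabilityMeasure (Fin k → ℝ))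
    (f : Fin k → Dataset X n → ℝ) (D : Dataset X n) {S : Set (Fin k → ℝ)} (hS : MeasurableSet S) :
    (additiveNoise ν f D : Measure (Fin k → ℝ)) S =
      (ν : Measure (Fin k → ℝ)) ((fun x => x + fun i => f i D) ⁻¹' S) :=
  Measure.map_apply (measurable_add_const _) hS

/-- Additive noise is private if each shift of its density by a vector with entries in `[-1, 1]`
costs at most a factor `exp ε`, outside a set of relative mass `δ`. -/
lemma isDP_additiveNoise {X : Type*} {n k : ℕ} {ε δ : ℝ} {W : (Fin k → ℝ) → ℝ≥0∞}
    (hW : Measurable W) (h0 : ∫⁻ x, W x ≠ 0) (htop : ∫⁻ x, W x ≠ ∞)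
    (h : ∀ v : Fin k → ℝ, (∀ i, |v i| ≤ 1) → ∃ B : Set (Fin k → ℝ), MeasurableSet B ∧
      (∀ x ∉ B, W x ≤ ENNReal.ofReal (Real.exp ε) * W (x + v)) ∧
      ∫⁻ x in B, W x ≤ ENNReal.ofReal δ * ∫⁻ x, W x)
    {f : Fin k → Dataset X n → ℝ} (hf : ∀ i, HasSensitivityOne (f i)) :
    IsDP ε δ (additiveNoise (normalizedLaw volume W h0 htop) f) := by
  intro D D' hD S hS
  obtain ⟨B, hB, hWB, hBδ⟩ := h (fun i => f i D - f i D') fun i => hf i D D' hD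
  have hm : ∀ w : Fin k → ℝ, MeasurableSet ((fun x => x + w) ⁻¹' S) :=
    fun w => measurable_add_const w hS
  rw [additiveNoise_apply _ _ _ hS, additiveNoise_apply _ _ _ hS, normalizedLaw_apply _ _ (hm _),
    normalizedLaw_apply _ _ (hm _)]
  have key := setLIntegral_le_of_shift volume _ hWB (hm fun i => f i D) (hm fun i => f i D')
    (fun x hx => by
      have : x + (fun i => f i D - f i D') + (fun i => f i D') = x + fun i => f i D := by
        ext i; simp [add_assoc]
      simpa [this] using hx) hW hB
  calc _ ≤ (∫⁻ x, W x)⁻¹ * (ENNReal.ofReal (Real.exp ε) *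
        (∫⁻ x in (fun x => x + fun i => f i D') ⁻¹' S, W x) +
          ENNReal.ofReal δ * ∫⁻ x, W x) := by
        gcongr
        exact key.trans (by gcongr)
    _ = _ := by
        rw [mul_add, mul_left_comm _ (ENNReal.ofReal δ), ENNReal.inv_mul_cancel h0 htop, mul_one,
          mul_left_comm]

lemma additiveNoise_error_eq_one {X : Type*} {n k : ℕ} {W : (Fin k → ℝ) → ℝ≥0∞}
    (h0 : ∫⁻ x, W x ≠ 0) (htop : ∫⁻ x, W x ≠ ∞) {r : ℝ} (hr : ∀ x, W x ≠ 0 → ‖x‖ ≤ r)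
    (f : Fin k → Dataset X n → ℝ) (D : Dataset X n) :
    (additiveNoise (normalizedLaw volume W h0 htop) f D : Measure (Fin k → ℝ))
      {y | ‖(fun i => f i D) - y‖ ≤ r} = 1 := by
  have hS : MeasurableSet {y : Fin k → ℝ | ‖(fun i => f i D) - y‖ ≤ r} :=
    measurableSet_le (by fun_prop) (by fun_prop)
  rw [additiveNoise_apply _ _ _ hS, normalizedLaw_apply _ _ (measurable_add_const _ hS),
    ← lintegral_indicator (measurable_add_const _ hS)]
  have : ((fun x => x + fun i => f i D) ⁻¹' {y | ‖(fun i => f i D) - y‖ ≤ r}).indicator W = W := by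
    refine Set.indicator_eq_self.2 fun x hx => ?_
    simpa using hr x hx
  rw [this, ENNReal.inv_mul_cancel h0 htop]

/-! ### Choice of the parameters -/

/-- The hypothesis of `isDP_additiveNoise` for `cubeNoise`. Both bad events get mass
`exp (-(2 * L))`, which for `L = log (1 / δ)` and `δ ≤ 1 / 2` leaves at most `δ` in total. -/
lemma exists_bad_set_cubeNoise {ε L R b : ℝ} (hε : 0 < ε) (hε1 : ε < 1) (hL : 1 / 2 ≤ L)
    (hb : b = 50 * L / ε) (hR : 0 ≤ R)
    (hR2 : R ^ 2 = (200 / ε) ^ 2 * ((Fintype.card ι + L) * L)) {v : ι → ℝ} (hv : ∀ i, |v i| ≤ 1) :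
    ∃ B : Set (ι → ℝ), MeasurableSet B ∧
      (∀ x : ι → ℝ, x ∉ B → cubeNoise (ε / 2) R (R - b) x ≤
        ENNReal.ofReal (Real.exp ε) * cubeNoise (ε / 2) R (R - b) (x + v)) ∧
      ∫⁻ x in B, cubeNoise (ε / 2) R (R - b) x ≤
        ENNReal.ofReal (2 * Real.exp (-(2 * L))) * ∫⁻ x : ι → ℝ, cubeNoise (ε / 2) R (R - b) x := by
  have hcd := continuous_coordDensity R
  set m : ℝ := (Fintype.card ι : ℝ) with hm
  have hm0 : 0 ≤ m := Nat.cast_nonneg _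
  have hbε : b * ε = 50 * L := by rw [hb]; field_simp
  have hb25 : 25 ≤ b := by rw [hb, le_div_iff₀ hε]; linarith
  have hlb : 8 * (6 * L / ε) ≤ b := by
    rw [hb, ← mul_div_assoc]; exact div_le_div_of_nonneg_right (by linarith) hε.le
  have hlam : 1 ≤ 6 * L / ε := by rw [le_div_iff₀ hε]; linarith
  have hR2' : R ^ 2 * ε ^ 2 = 40000 * ((m + L) * L) := by rw [hR2]; field_simp; ring
  have hbR : 4 * b ≤ R := by
    refine (sq_le_sq₀ (by positivity) hR).1 ?_
    have : (4 * b) ^ 2 = (200 / ε) ^ 2 * (L * L) := by rw [hb]; ring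
    rw [this, hR2]
    gcongr; linarith
  have hR0 : 0 < R := by linarith
  have hshell : m * (192 * (b ^ 3 / R ^ 3)) - ε / 2 * (b - 1) ≤ -(2 * L) := by
    have h1 : b / R ≤ 1 / 4 := by rw [div_le_div_iff₀ hR0 (by norm_num)]; linarith
    have h2 : m * (b ^ 2 / R ^ 2) ≤ L / 16 := by
      rw [← mul_div_assoc, div_le_div_iff₀ (by positivity) (by norm_num)]
      refine le_of_mul_le_mul_right ?_ (by positivity : 0 < ε ^ 2)
      have h3 : b ^ 2 * ε ^ 2 = 2500 * L ^ 2 := by rw [← mul_pow, hbε]; ring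
      calc m * b ^ 2 * 16 * ε ^ 2 = 16 * m * (b ^ 2 * ε ^ 2) := by ring
        _ = 40000 * m * L ^ 2 := by rw [h3]; ring
        _ ≤ L * (40000 * ((m + L) * L)) := by nlinarith [pow_pos (by linarith : 0 < L) 3]
        _ = L * R ^ 2 * ε ^ 2 := by rw [← hR2']; ring
    have h3 : m * (b ^ 3 / R ^ 3) ≤ L / 16 * (1 / 4) := by
      calc m * (b ^ 3 / R ^ 3) = m * (b ^ 2 / R ^ 2) * (b / R) := by field_simp
        _ ≤ _ := by gcongr
    nlinarith
  have hloss : m * (258 * ((6 * L / ε) ^ 2 / R ^ 2)) - 6 * L / ε * (ε / 2) ≤ -(2 * L) := by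
    have h1 : 6 * L / ε * (ε / 2) = 3 * L := by field_simp; ring
    have h2 : m * (258 * ((6 * L / ε) ^ 2 / R ^ 2)) ≤ L := by
      have : m * (258 * ((6 * L / ε) ^ 2 / R ^ 2)) = 9288 * m * L ^ 2 / (R ^ 2 * ε ^ 2) := by
        field_simp; ring
      rw [this, hR2', div_le_iff₀ (by positivity)]
      nlinarith [pow_pos (by linarith : 0 < L) 3, mul_nonneg hm0 (sq_nonneg L)]
    linarith
  refine ⟨{x | R - b - 1 < ‖x‖} ∪ {x | Real.exp (ε / 2) * ∏ i, coordDensity R (x i + v i) <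
    ∏ i, coordDensity R (x i)}, ?_, fun x hx => ?_, ?_⟩
  · exact (measurableSet_lt (by fun_prop) (by fun_prop)).union
      (measurableSet_lt (by fun_prop) (by fun_prop))
  · simp only [Set.mem_union, Set.mem_ofPred_eq, not_or, not_lt] at hx
    have h := cubeNoise_le_shift (by linarith : 0 ≤ ε / 2)
      ((pi_norm_le_iff_of_nonneg zero_le_one).2 hv) hx.1 hx.2
    rwa [add_halves] at h
  · refine (lintegral_union_le _ _ _).trans ?_
    rw [two_mul, ENNReal.ofReal_add (Real.exp_pos _).le (Real.exp_pos _).le, add_mul]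
    gcongr
    · refine (setLIntegral_cubeNoise_shell_le (by linarith) (by linarith) hbR).trans ?_
      gcongr
    · refine (setLIntegral_cubeNoise_loss_le (by linarith) hb25 (by linarith) hlam hlb hv).trans ?_
      gcongr

end QueryRelease

theorem theorem4 :
    ∃ C : ℝ, 0 < C ∧
      ∀ ε δ : ℝ, 0 < ε → ε < 1 → 0 < δ → δ < 1 / 2 →
      ∀ (k n : ℕ) (X : Type*), ∃ A : QueryRelease.QueryAlgorithm X n k,
        ∀ f : Fin k → QueryRelease.Dataset X n → ℝ,
          (∀ i, QueryRelease.HasSensitivityOne (f i)) →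
            QueryRelease.IsDP ε δ (A f) ∧
            ∀ D : QueryRelease.Dataset X n,
              (A f D : MeasureTheory.Measure (Fin k → ℝ))
                {a | ‖(fun i => f i D) - a‖ ≤
                  C * ((√(k * Real.log (1 / δ)) + Real.log (1 / δ)) / ε)} = 1 := by
  refine ⟨200, by norm_num, fun ε δ hε hε1 hδ hδ2 k n X => ?_⟩
  set L := Real.log (1 / δ) with hLdef
  have hδL : Real.exp (-L) = δ := by
    rw [hLdef, one_div, Real.log_inv, neg_neg, Real.exp_log hδ]
  have hL : 1 / 2 ≤ L := by
    have h2 : Real.log 2 ≤ L := Real.log_le_log (by norm_num) (by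
      rw [le_div_iff₀ hδ]; linarith)
    linarith [Real.log_two_gt_d9]
  have hk : (0 : ℝ) ≤ k := Nat.cast_nonneg k
  set b := 50 * L / ε with hb
  set R := 200 / ε * √((k + L) * L) with hRdef
  have hR0 : 0 ≤ R := by positivity
  have hR2 : R ^ 2 = (200 / ε) ^ 2 * ((Fintype.card (Fin k) + L) * L) := by
    rw [hRdef, mul_pow, Real.sq_sqrt (by positivity), Fintype.card_fin]
  have hb0 : 0 < b := by positivity
  have hRL : 200 / ε * L ≤ R := by
    rw [hRdef]
    gcongr
    exact Real.le_sqrt_of_sq_le (by nlinarith)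
  have hbR : b < R := by
    refine lt_of_lt_of_le ?_ hRL
    have : 200 / ε * L = 4 * b := by rw [hb]; ring
    linarith
  have hRle : R ≤ 200 * ((√(k * L) + L) / ε) := by
    have h1 : √((k + L) * L) ≤ √(k * L) + L := by
      rw [Real.sqrt_le_left (by positivity)]
      nlinarith [Real.sq_sqrt (by positivity : 0 ≤ k * L),
        mul_nonneg (Real.sqrt_nonneg (k * L)) (by linarith : 0 ≤ L)]
    calc R ≤ 200 / ε * (√(k * L) + L) := by rw [hRdef]; gcongr
      _ = _ := by ring
  have hδ' : 2 * Real.exp (-(2 * L)) ≤ δ := by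
    have : Real.exp (-(2 * L)) = δ * δ := by
      rw [← hδL, ← Real.exp_add]; ring_nf
    rw [this]; nlinarith
  have h0 := QueryRelease.lintegral_cubeNoise_ne_zero (ι := Fin k) (a := ε / 2) (R := R)
    (T := R - b) (by linarith) (by linarith) (by linarith)
  have htop := QueryRelease.lintegral_cubeNoise_ne_top (ι := Fin k) (a := ε / 2) (R := R)
    (T := R - b) (by linarith) (by linarith)
  refine ⟨QueryRelease.additiveNoise (QueryRelease.normalizedLaw MeasureTheory.volume
    (QueryRelease.cubeNoise (ε / 2) R (R - b)) h0 htop), fun f hf => ⟨?_, fun D => ?_⟩⟩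
  · refine QueryRelease.isDP_additiveNoise (QueryRelease.measurable_cubeNoise _ _ _) h0 htop
      (fun v hv => ?_) hf
    obtain ⟨B, hB, hB1, hB2⟩ :=
      QueryRelease.exists_bad_set_cubeNoise hε hε1 hL hb hR0 hR2 hv
    exact ⟨B, hB, hB1, hB2.trans (by gcongr)⟩
  · refine QueryRelease.additiveNoise_error_eq_one h0 htop (fun x hx => ?_) f D
    by_contra hlt
    exact hx (QueryRelease.cubeNoise_of_lt (by linarith))
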